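/- For integers $m_1,\dots,m_e\ge 2$ write $$(m_1,\dots,m_e)=\langle x_1,\dots,x_e \mid x_1^{m_1}=\cdots=x_e^{m_e}=x_1x_2\cdots x_e=1\rangle .$$ Call this group a (Fuchsian) Dyck group if $-2+\sum_{i=1}^{e}\bigl(1-\tfrac1{m_i}\bigr)>0$, and a Fuchsian triangle group if in addition $e=3$. Say that a group $G$ surjects almost all alternating groups if, for all but finitely many $n$, there is a surjective homomorphism $G\to A_n$. Suppose that each of the following groups surjects almost all alternating groups: 1. every Fuchsian triangle group $(p,q,r)$ with $2\le p<q<r$ distinct primes; 2. every triangle group $(2,4,r)$ with $r\ge 5$ prime; 3. the twelve groups $(2,3,8)$, $(2,3,9)$, $(2,3,10)$, $(2,3,12)$, $(2,3,15)$, $(2,3,25)$, $(2,4,6)$, $(2,4,8)$, $(2,4,9)$, $(2,5,6)$, $(2,5,9)$ and $(3,4,5)$; 4. the groups $(2,3,3,3)$ and $(3,3,3,3)$. Then every Dyck group surjects almost all alternating groups. -/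

import Mathlib

/-- The relators of the Dyck group `(m₁, …, mₑ)` with generators `x₁, …, xₑ`:
the words `xᵢ ^ mᵢ` and the word `x₁ x₂ ⋯ xₑ`. -/
def dyckRelators {e : ℕ} (m : Fin e → ℕ) : Set (FreeGroup (Fin e)) :=
  (Set.range fun i => FreeGroup.of i ^ m i) ∪ {(List.ofFn fun i => FreeGroup.of i).prod}

/-- The group `⟨x₁, …, xₑ | x₁ ^ m₁ = ⋯ = xₑ ^ mₑ = x₁ x₂ ⋯ xₑ = 1⟩` of signature
`(m₁, …, mₑ)` (genus zero, no punctures and no boundary components). -/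
abbrev DyckGroup {e : ℕ} (m : Fin e → ℕ) : Type := PresentedGroup (dyckRelators m)

/-- The Riemann-Hurwitz quantity `μ = 2g - 2 + ∑ (1 - 1 / mᵢ)` in genus `g = 0`, without
punctures and boundary components. -/
def dyckMu {e : ℕ} (m : Fin e → ℕ) : ℚ := -2 + ∑ i, (1 - 1 / (m i : ℚ))

/-- `(m₁, …, mₑ)` is the signature of a Fuchsian (hyperbolic) Dyck group: every period is at
least two and `μ > 0`. -/
def IsFuchsianSignature {e : ℕ} (m : Fin e → ℕ) : Prop := (∀ i, 2 ≤ m i) ∧ 0 < dyckMu m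

/-- All but finitely many of the alternating groups `Aₙ` are homomorphic images of `G`. -/
def SurjectsAlmostAllAlternating (G : Type*) [Group G] : Prop :=
  {n : ℕ | ¬ ∃ f : G →* alternatingGroup (Fin n), Function.Surjective f}.Finite

/-! A surjection from a Dyck group onto `G` is the same as a generating vector of `G`, and only
divisibility of orders is asked of its entries. Hence the signatures realised in `G` are closed
under permutation (conjugating one entry past its neighbour), under replacing a period by a
multiple, and under adding a period (insert the identity).

The one further operation is `HasGeneratingVector.double_cover`, which passes from (2a, 2b, l) to
(a, b, l, l). The Dyck group of the former contains the latter as the kernel of a map onto the group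
of order two, and a group without index-two subgroups remains an image of that kernel. Alternating
groups are of this kind, by `alternatingGroup_eq_top_of_two_cosets`. A special case takes (2, r, 2s)
to (r, r, s).

What remains is arithmetic: every hyperbolic signature is reached from the base ones. Triangles with
a period 2 come from prime factorisation, the other triangles by divisibility and the isosceles
covers, and signatures with four or more periods by dropping periods or from covers of triangles;
(2,3,3,3) and (3,3,3,3) are base cases. -/

/-! ### Generating vectors and operations on signatures -/

/-- A generating vector of signature `l`: elements `gᵢ` with `gᵢ ^ lᵢ = 1` and product one that lie
together in no proper subgroup. -/
def HasGeneratingVector (G : Type*) [Group G] (l : List ℕ) : Prop :=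
  ∃ g : List G, List.Forall₂ (fun x k => x ^ k = 1) g l ∧ g.prod = 1 ∧
    ∀ K : Subgroup G, (∀ x ∈ g, x ∈ K) → K = ⊤

theorem hasGeneratingVector_of_surjective {G : Type*} [Group G] {e : ℕ} {m : Fin e → ℕ}
    (f : DyckGroup m →* G) (hf : Function.Surjective f) :
    HasGeneratingVector G (List.ofFn m) := by
  refine ⟨List.ofFn fun i => f (PresentedGroup.of i), ?_, ?_, fun K hK => ?_⟩
  · rw [List.forall₂_iff_get]
    refine ⟨by simp, fun i h₁ h₂ => ?_⟩
    simp only [List.get_eq_getElem, List.getElem_ofFn]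
    rw [← map_pow, ← map_one f]
    congr 1
    exact PresentedGroup.one_of_mem (rels := dyckRelators m)
      (Set.mem_union_left _ (Set.mem_range_self (⟨i, by simpa using h₂⟩ : Fin e)))
  · have h : PresentedGroup.mk (dyckRelators m) (List.ofFn fun i => FreeGroup.of i).prod = 1 :=
      PresentedGroup.one_of_mem (Set.mem_union_right _ rfl)
    have h' := congrArg f h
    rw [map_one, map_list_prod, map_list_prod, List.map_ofFn, List.map_ofFn] at h'
    exact h'
  · have h : K.comap f = ⊤ := by
      rw [eq_top_iff, ← PresentedGroup.closure_range_of, Subgroup.closure_le]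
      rintro _ ⟨i, rfl⟩
      exact hK _ ((List.mem_ofFn' _ _).2 ⟨i, rfl⟩)
    rw [eq_top_iff]
    intro y _
    obtain ⟨x, rfl⟩ := hf y
    exact (Subgroup.mem_comap).1 (h ▸ Subgroup.mem_top x)

theorem HasGeneratingVector.exists_surjective {G : Type*} [Group G] {e : ℕ} {m : Fin e → ℕ}
    (h : HasGeneratingVector G (List.ofFn m)) :
    ∃ f : DyckGroup m →* G, Function.Surjective f := by
  obtain ⟨g, hpow, hprod, hgen⟩ := h
  rw [List.forall₂_iff_get] at hpow
  obtain ⟨hlen, hpow⟩ := hpow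
  rw [List.length_ofFn] at hlen
  subst hlen
  have hrel : ∀ r ∈ dyckRelators m, FreeGroup.lift g.get r = 1 := by
    rintro r (⟨i, rfl⟩ | rfl)
    · simpa using hpow i i.2 (by simp)
    · rw [map_list_prod, List.map_ofFn]
      simpa [Function.comp_def] using hprod
  refine ⟨PresentedGroup.toGroup hrel, MonoidHom.range_eq_top.1 (hgen _ fun x hx => ?_)⟩
  obtain ⟨i, rfl⟩ := List.get_of_mem hx
  exact ⟨PresentedGroup.of i, PresentedGroup.toGroup.of hrel⟩

namespace HasGeneratingVector

variable {G : Type*} [Group G]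

/-- The braid move (y, x) ↦ (yxy⁻¹, y) swaps adjacent periods and preserves both the product and the
generated subgroup. -/
theorem perm {l l' : List ℕ} (hl : l.Perm l') (h : HasGeneratingVector G l) :
    HasGeneratingVector G l' := by
  -- Tails of a generating vector need neither have product one nor generate, so the induction
  -- tracks the product and the generated subgroup instead.
  suffices H : ∀ g : List G, List.Forall₂ (fun x k => x ^ k = 1) g l →
      ∃ g' : List G, List.Forall₂ (fun x k => x ^ k = 1) g' l' ∧ g'.prod = g.prod ∧
        ∀ K : Subgroup G, (∀ x ∈ g', x ∈ K) → ∀ x ∈ g, x ∈ K by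
    obtain ⟨g, hpow, hprod, hgen⟩ := h
    obtain ⟨g', hpow', hprod', hgen'⟩ := H g hpow
    exact ⟨g', hpow', hprod'.trans hprod, fun K hK => hgen K (hgen' K hK)⟩
  clear h
  induction hl with
  | nil => exact fun g hg => ⟨g, hg, rfl, fun _ h => h⟩
  | cons a _ ih =>
    rintro _ (_ | @⟨x, _, g, _, hx, hg⟩)
    obtain ⟨g', h₁, h₂, h₃⟩ := ih g hg
    refine ⟨x :: g', h₁.cons hx, by simp [h₂], fun K hK => ?_⟩
    rw [List.forall_mem_cons] at hK ⊢
    exact ⟨hK.1, h₃ K hK.2⟩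
  | swap a b l =>
    rintro _ (_ | @⟨y, _, _, _, hy, (_ | @⟨x, _, g, _, hx, hg⟩)⟩)
    refine ⟨(y * x * y⁻¹) :: y :: g, .cons (by rw [conj_pow, hx]; simp) (.cons hy hg),
      by simp [mul_assoc], fun K hK => ?_⟩
    simp only [List.forall_mem_cons] at hK ⊢
    refine ⟨hK.2.1, ?_, hK.2.2⟩
    have := K.mul_mem (K.mul_mem (K.inv_mem hK.2.1) hK.1) hK.2.1
    simpa [mul_assoc] using this
  | trans _ _ ih₁ ih₂ =>
    intro g hg
    obtain ⟨g₁, h₁, h₂, h₃⟩ := ih₁ g hg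
    obtain ⟨g₂, h₁', h₂', h₃'⟩ := ih₂ g₁ h₁
    exact ⟨g₂, h₁', h₂'.trans h₂, fun K hK => h₃ K (h₃' K hK)⟩

theorem of_forall_dvd {l l' : List ℕ} (hl : List.Forall₂ (· ∣ ·) l l')
    (h : HasGeneratingVector G l) : HasGeneratingVector G l' := by
  obtain ⟨g, hpow, hprod, hgen⟩ := h
  refine ⟨g, ?_, hprod, hgen⟩
  clear hprod hgen
  induction hl generalizing g with
  | nil => exact hpow
  | cons hab _ ih =>
    obtain _ | ⟨hx, hg⟩ := hpow
    obtain ⟨c, rfl⟩ := hab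
    exact (ih _ hg).cons (by rw [pow_mul, hx, one_pow])

theorem cons (a : ℕ) {l : List ℕ} (h : HasGeneratingVector G l) :
    HasGeneratingVector G (a :: l) := by
  obtain ⟨g, hpow, hprod, hgen⟩ := h
  exact ⟨1 :: g, hpow.cons (one_pow a), by simpa using hprod,
    fun K hK => hgen K (List.forall_mem_cons.1 hK).2⟩

theorem of_one_cons {l : List ℕ} (h : HasGeneratingVector G (1 :: l)) :
    HasGeneratingVector G l := by
  obtain ⟨_, (_ | ⟨hx, hg⟩), hprod, hgen⟩ := h
  rw [pow_one] at hx
  subst hx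
  refine ⟨_, hg, by simpa using hprod, fun K hK => hgen K ?_⟩
  exact List.forall_mem_cons.2 ⟨K.one_mem, hK⟩

/-- The double cover branched over the first two cone points. The hypothesis on `G` says that `G`
has no subgroup of index two. -/
theorem double_cover {a b : ℕ} {l : List ℕ}
    (hG : ∀ (K : Subgroup G) (x : G), (∀ g, g ∈ K ∨ g * x ∈ K) → K = ⊤)
    (h : HasGeneratingVector G (2 * a :: 2 * b :: l)) :
    HasGeneratingVector G (a :: b :: (l ++ l)) := by
  suffices H : HasGeneratingVector G (l ++ b :: (l ++ [a])) by
    refine H.perm ?_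
    rw [List.perm_iff_count]
    intro c
    simp only [List.count_append, List.count_cons, List.count_nil]
    omega
  obtain ⟨_, (_ | @⟨x, _, _, _, hx, (_ | @⟨y, _, z, _, hy, hz⟩)⟩), hprod, hgen⟩ := h
  have hy' : y = x⁻¹ * z.prod⁻¹ := by
    rw [List.prod_cons, List.prod_cons, ← mul_assoc] at hprod
    rw [eq_inv_mul_iff_mul_eq]
    exact eq_inv_of_mul_eq_one_left hprod
  -- Generators of the index-two kernel for the coset representatives 1 and x: the entries z, their
  -- conjugates by x, and the squares of the two branch generators. The product is one because xy ·
  -- z.prod = 1.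
  refine ⟨z ++ (x * y ^ 2 * x⁻¹) :: (z.map (MulAut.conj x) ++ [x ^ 2]), ?_, ?_, fun K hK => ?_⟩
  · refine List.rel_append hz (List.Forall₂.cons ?_ (List.rel_append ?_ ?_))
    · rw [conj_pow, ← pow_mul, hy]
      simp
    · rw [List.forall₂_map_left_iff]
      refine hz.imp fun u k hu => ?_
      rw [← map_pow, hu, map_one]
    · exact List.Forall₂.cons (by rw [← pow_mul, hx]) List.Forall₂.nil
  · rw [List.prod_append, List.prod_cons, List.prod_append, List.prod_hom, List.prod_singleton,
      MulAut.conj_apply, hy']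
    simp [pow_two, mul_assoc]
  · simp only [List.mem_append, List.mem_cons, List.mem_map, List.not_mem_nil, or_false] at hK
    have hzK : ∀ u ∈ z, u ∈ K := fun u hu => hK u (Or.inl hu)
    have hxK : x ^ 2 ∈ K := hK _ (by simp)
    have hcK : ∀ u ∈ z, x⁻¹ * u * x ∈ K := by
      intro u hu
      have h₁ : x * u * x⁻¹ ∈ K := hK _ (Or.inr (Or.inr (Or.inl ⟨u, hu, MulAut.conj_apply x u⟩)))
      have h₂ := K.mul_mem (K.mul_mem (K.inv_mem hxK) h₁) hxK
      have h₃ : (x ^ 2)⁻¹ * (x * u * x⁻¹) * x ^ 2 = x⁻¹ * u * x := by group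
      rwa [h₃] at h₂
    -- K contains x² and both z and x⁻¹zx, so multiplying on the right by a generator preserves or
    -- exchanges the alternatives g ∈ K and gx ∈ K.
    refine hG K x fun g => ?_
    have htop : Subgroup.closure ({x} ∪ {u | u ∈ z}) = ⊤ := by
      have hxC : x ∈ Subgroup.closure ({x} ∪ {u | u ∈ z}) :=
        Subgroup.subset_closure (Or.inl rfl)
      have hzC : ∀ u ∈ z, u ∈ Subgroup.closure ({x} ∪ {u | u ∈ z}) :=
        fun u hu => Subgroup.subset_closure (Or.inr hu)
      refine hgen _ ?_
      rw [List.forall_mem_cons, List.forall_mem_cons]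
      refine ⟨hxC, ?_, hzC⟩
      rw [hy']
      exact mul_mem (inv_mem hxC) (inv_mem (list_prod_mem hzC))
    have hg : g ∈ Subgroup.closure ({x} ∪ {u | u ∈ z}) := htop ▸ Subgroup.mem_top g
    induction hg using Subgroup.closure_induction_right with
    | one => exact Or.inl K.one_mem
    | mul_right w _ u hu ih =>
      rcases hu with rfl | hu
      · refine ih.symm.imp id fun h => ?_
        rw [mul_assoc, ← pow_two]
        exact K.mul_mem h hxK
      · refine ih.imp (fun h => K.mul_mem h (hzK u hu)) fun h => ?_
        have := K.mul_mem h (hcK u hu)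
        simpa [mul_assoc] using this
    | mul_inv_cancel w _ u hu ih =>
      rcases hu with rfl | hu
      · refine ih.symm.imp (fun h => ?_) fun h => by simpa using h
        have := K.mul_mem h (K.inv_mem hxK)
        simpa [mul_assoc, pow_two] using this
      · refine ih.imp (fun h => K.mul_mem h (K.inv_mem (hzK u hu))) fun h => ?_
        have := K.mul_mem h (K.inv_mem (hcK u hu))
        simpa [mul_assoc] using this

end HasGeneratingVector

/-- If g³ = 1 and g ∉ K, then g² = g⁻¹ ∉ K, so gx and g²x both lie in K and their quotient g does
too, a contradiction. Thus K contains all 3-cycles, which generate. -/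
theorem alternatingGroup_eq_top_of_two_cosets {n : ℕ} (K : Subgroup (alternatingGroup (Fin n)))
    (x : alternatingGroup (Fin n)) (hK : ∀ g, g ∈ K ∨ g * x ∈ K) : K = ⊤ := by
  have hthree : ∀ g : alternatingGroup (Fin n), g ^ 3 = 1 → g ∈ K := by
    intro g hg
    by_contra hgK
    have hinv : g ^ 2 = g⁻¹ := by
      rw [eq_inv_iff_mul_eq_one, ← pow_succ, hg]
    have h₁ := (hK g).resolve_left hgK
    have h₂ := (hK (g ^ 2)).resolve_left (by rwa [hinv, K.inv_mem_iff])
    have h₃ := K.mul_mem h₂ (K.inv_mem h₁)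
    rw [show g ^ 2 * x * (g * x)⁻¹ = g by group] at h₃
    exact hgK h₃
  have hle : alternatingGroup (Fin n) ≤ K.map (alternatingGroup (Fin n)).subtype := by
    conv_lhs => rw [← Equiv.Perm.closure_three_cycles_eq_alternating]
    rw [Subgroup.closure_le]
    intro σ hσ
    refine ⟨⟨σ, hσ.mem_alternatingGroup⟩, hthree _ (Subtype.ext ?_), rfl⟩
    rw [SubgroupClass.coe_pow, ← Equiv.Perm.IsThreeCycle.orderOf hσ]
    exact pow_orderOf_eq_one σ
  rw [eq_top_iff]
  rintro ⟨σ, hσ⟩ -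
  obtain ⟨τ, hτ, h⟩ := hle hσ
  have : τ = ⟨σ, hσ⟩ := Subtype.ext h
  exact this ▸ hτ

/-! ### Signatures realised in almost all alternating groups -/

/-- The Dyck group of signature `l` surjects almost all alternating groups, expressed by
generating vectors. -/
def IsAlternatingSignature (l : List ℕ) : Prop :=
  ∀ᶠ n in Filter.atTop, HasGeneratingVector (alternatingGroup (Fin n)) l

theorem surjectsAlmostAllAlternating_iff {e : ℕ} (m : Fin e → ℕ) :
    SurjectsAlmostAllAlternating (DyckGroup m) ↔ IsAlternatingSignature (List.ofFn m) := by
  rw [IsAlternatingSignature, ← Nat.cofinite_eq_atTop, Filter.eventually_cofinite]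
  have h : ∀ n, (∃ f : DyckGroup m →* alternatingGroup (Fin n), Function.Surjective f) ↔
      HasGeneratingVector (alternatingGroup (Fin n)) (List.ofFn m) := fun n =>
    ⟨fun ⟨f, hf⟩ => hasGeneratingVector_of_surjective f hf, fun h => h.exists_surjective⟩
  simp only [SurjectsAlmostAllAlternating, h]

namespace IsAlternatingSignature

theorem perm {l l' : List ℕ} (h : IsAlternatingSignature l) (hl : l.Perm l') :
    IsAlternatingSignature l' :=
  h.mono fun _ hn => hn.perm hl

theorem of_forall_dvd {l l' : List ℕ} (h : IsAlternatingSignature l)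
    (hl : List.Forall₂ (· ∣ ·) l l') : IsAlternatingSignature l' :=
  h.mono fun _ hn => hn.of_forall_dvd hl

theorem cons (a : ℕ) {l : List ℕ} (h : IsAlternatingSignature l) :
    IsAlternatingSignature (a :: l) :=
  h.mono fun _ hn => hn.cons a

theorem append_left (t : List ℕ) {l : List ℕ} (h : IsAlternatingSignature l) :
    IsAlternatingSignature (t ++ l) := by
  induction t with
  | nil => exact h
  | cons a t ih => exact ih.cons a

theorem of_one_cons {l : List ℕ} (h : IsAlternatingSignature (1 :: l)) :
    IsAlternatingSignature l :=
  h.mono fun _ hn => hn.of_one_cons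

theorem double_cover {a b : ℕ} {l : List ℕ} (h : IsAlternatingSignature (2 * a :: 2 * b :: l)) :
    IsAlternatingSignature (a :: b :: (l ++ l)) :=
  h.mono fun _ hn => hn.double_cover alternatingGroup_eq_top_of_two_cosets

theorem swap {a b c : ℕ} (h : IsAlternatingSignature [a, b, c]) :
    IsAlternatingSignature [b, a, c] :=
  h.perm (.swap _ _ _)

theorem rotate {a b c : ℕ} (h : IsAlternatingSignature [a, b, c]) :
    IsAlternatingSignature [b, c, a] :=
  h.perm (List.perm_append_comm (l₁ := [a]))

theorem swap_right {a b c : ℕ} (h : IsAlternatingSignature [a, b, c]) :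
    IsAlternatingSignature [a, c, b] :=
  h.rotate.rotate.swap

theorem dvd {a b c a' b' c' : ℕ} (h : IsAlternatingSignature [a, b, c]) (ha : a ∣ a')
    (hb : b ∣ b') (hc : c ∣ c') : IsAlternatingSignature [a', b', c'] :=
  h.of_forall_dvd (.cons ha (.cons hb (.cons hc .nil)))

/-- The double cover branched over the periods 2 = 2 · 1 and 2s; the resulting period 1 is dropped.
-/
theorem isosceles {r s : ℕ} (h : IsAlternatingSignature [2, r, 2 * s]) :
    IsAlternatingSignature [r, r, s] := by
  have h' : IsAlternatingSignature [2 * 1, 2 * s, r] := h.perm ((List.Perm.swap _ _ _).cons _)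
  exact h'.double_cover.of_one_cons.rotate

end IsAlternatingSignature

/-! ### Triangle signatures -/

/-- The signatures from which every hyperbolic signature is derived. -/
structure BaseSignaturesAlternating : Prop where
  primes {p q r : ℕ} : p.Prime → q.Prime → r.Prime → p < q → q < r → 7 ≤ r →
    IsAlternatingSignature [p, q, r]
  two_four {r : ℕ} : r.Prime → 5 ≤ r → IsAlternatingSignature [2, 4, r]
  triangle {m : Fin 3 → ℕ} : m ∈ ([![2, 3, 8], ![2, 3, 9], ![2, 3, 10], ![2, 3, 12], ![2, 3, 15],
      ![2, 3, 25], ![2, 4, 6], ![2, 4, 8], ![2, 4, 9], ![2, 5, 6], ![2, 5, 9], ![3, 4, 5]] :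
        List (Fin 3 → ℕ)) → IsAlternatingSignature (List.ofFn m)
  two_three_three_three : IsAlternatingSignature [2, 3, 3, 3]
  three_three_three_three : IsAlternatingSignature [3, 3, 3, 3]

theorem Nat.Prime.eq_two_or_three_or_five_or_seven_le {p : ℕ} (hp : p.Prime) :
    p = 2 ∨ p = 3 ∨ p = 5 ∨ 7 ≤ p := by
  by_contra! h
  have := hp.two_le
  have : p = 4 ∨ p = 6 := by omega
  rcases this with rfl | rfl <;> revert hp <;> decide

theorem exists_dvd_three_or_four_or_five_or_prime {n : ℕ} (hn : 3 ≤ n) :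
    3 ∣ n ∨ 4 ∣ n ∨ 5 ∣ n ∨ ∃ p, p.Prime ∧ 7 ≤ p ∧ p ∣ n := by
  rcases Nat.four_dvd_or_exists_odd_prime_and_dvd_of_two_lt hn with h | ⟨p, hp, hpn, hodd⟩
  · exact Or.inr (Or.inl h)
  · rcases hp.eq_two_or_three_or_five_or_seven_le with rfl | rfl | rfl | h
    · exact absurd hodd (by decide)
    · exact Or.inl hpn
    · exact Or.inr (Or.inr (Or.inl hpn))
    · exact Or.inr (Or.inr (Or.inr ⟨p, hp, h, hpn⟩))

namespace BaseSignaturesAlternating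

/-- Every n ≥ 7 is divisible by a prime at least 7 or by one of 8, 9, 10, 12, 15, 25. -/
theorem two_three (H : BaseSignaturesAlternating) {n : ℕ} (hn : 7 ≤ n) :
    IsAlternatingSignature [2, 3, n] := by
  have key : ∀ k, k ∣ n → IsAlternatingSignature [2, 3, k] → IsAlternatingSignature [2, 3, n] :=
    fun k hk h => h.dvd dvd_rfl dvd_rfl hk
  have h8 : IsAlternatingSignature [2, 3, 8] := H.triangle (m := ![2, 3, 8]) (by simp)
  have h9 : IsAlternatingSignature [2, 3, 9] := H.triangle (m := ![2, 3, 9]) (by simp)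
  have h10 : IsAlternatingSignature [2, 3, 10] := H.triangle (m := ![2, 3, 10]) (by simp)
  have h12 : IsAlternatingSignature [2, 3, 12] := H.triangle (m := ![2, 3, 12]) (by simp)
  have h15 : IsAlternatingSignature [2, 3, 15] := H.triangle (m := ![2, 3, 15]) (by simp)
  have h25 : IsAlternatingSignature [2, 3, 25] := H.triangle (m := ![2, 3, 25]) (by simp)
  have hprime : ∀ p, p.Prime → 7 ≤ p → p ∣ n → IsAlternatingSignature [2, 3, n] :=
    fun p hp h7 hpn => key p hpn
      (H.primes Nat.prime_two Nat.prime_three hp (by norm_num) (by omega) h7)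
  rcases exists_dvd_three_or_four_or_five_or_prime (by omega : 3 ≤ n) with
    ⟨k, hk⟩ | ⟨k, hk⟩ | ⟨k, hk⟩ | ⟨p, hp, h7, hpn⟩
  · rcases exists_dvd_three_or_four_or_five_or_prime (by omega : 3 ≤ k) with
      h | h | h | ⟨p, hp, h7, hpn⟩
    · exact key 9 (by omega) h9
    · exact key 12 (by omega) h12
    · exact key 15 (by omega) h15
    · exact hprime p hp h7 (hk ▸ hpn.mul_left 3)
  · by_cases h2 : k = 2
    · exact key 8 (by omega) h8
    rcases exists_dvd_three_or_four_or_five_or_prime (by omega : 3 ≤ 2 * k) with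
      h | h | h | ⟨p, hp, h7, hpn⟩
    · exact key 12 (by omega) h12
    · exact key 8 (by omega) h8
    · exact key 10 (by omega) h10
    · exact hprime p hp h7 (hk ▸ hpn.trans ⟨2, by ring⟩)
  · by_cases h2 : k = 2
    · exact key 10 (by omega) h10
    rcases exists_dvd_three_or_four_or_five_or_prime (by omega : 3 ≤ k) with
      h | h | h | ⟨p, hp, h7, hpn⟩
    · exact key 15 (by omega) h15
    · exact key 10 (by omega) h10
    · exact key 25 (by omega) h25
    · exact hprime p hp h7 (hk ▸ hpn.mul_left 5)
  · exact hprime p hp h7 hpn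

theorem two_four_of_le (H : BaseSignaturesAlternating) {n : ℕ} (hn : 5 ≤ n) :
    IsAlternatingSignature [2, 4, n] := by
  have key : ∀ k, k ∣ n → IsAlternatingSignature [2, 4, k] → IsAlternatingSignature [2, 4, n] :=
    fun k hk h => h.dvd dvd_rfl dvd_rfl hk
  have h6 : IsAlternatingSignature [2, 4, 6] := H.triangle (m := ![2, 4, 6]) (by simp)
  have h8 : IsAlternatingSignature [2, 4, 8] := H.triangle (m := ![2, 4, 8]) (by simp)
  have h9 : IsAlternatingSignature [2, 4, 9] := H.triangle (m := ![2, 4, 9]) (by simp)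
  have h5 := H.two_four Nat.prime_five le_rfl
  have hprime : ∀ p, p.Prime → 7 ≤ p → p ∣ n → IsAlternatingSignature [2, 4, n] :=
    fun p hp h7 hpn => key p hpn (H.two_four hp (by omega))
  rcases exists_dvd_three_or_four_or_five_or_prime (by omega : 3 ≤ n) with
    ⟨k, hk⟩ | ⟨k, hk⟩ | h | ⟨p, hp, h7, hpn⟩
  · by_cases h2 : k = 2
    · exact key 6 (by omega) h6
    rcases exists_dvd_three_or_four_or_five_or_prime (by omega : 3 ≤ k) with
      h | h | h | ⟨p, hp, h7, hpn⟩
    · exact key 9 (by omega) h9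
    · exact key 6 (by omega) h6
    · exact key 5 (by omega) h5
    · exact hprime p hp h7 (hk ▸ hpn.mul_left 3)
  · by_cases h2 : k = 2
    · exact key 8 (by omega) h8
    rcases exists_dvd_three_or_four_or_five_or_prime (by omega : 3 ≤ k) with
      h | h | h | ⟨p, hp, h7, hpn⟩
    · exact key 6 (by omega) h6
    · exact key 8 (by omega) h8
    · exact key 5 (by omega) h5
    · exact hprime p hp h7 (hk ▸ hpn.mul_left 4)
  · exact key 5 h h5
  · exact hprime p hp h7 hpn

theorem two_five (H : BaseSignaturesAlternating) {n : ℕ} (hn : 4 ≤ n) :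
    IsAlternatingSignature [2, 5, n] := by
  have key : ∀ k, k ∣ n → IsAlternatingSignature [2, 5, k] → IsAlternatingSignature [2, 5, n] :=
    fun k hk h => h.dvd dvd_rfl dvd_rfl hk
  have h4 : IsAlternatingSignature [2, 5, 4] :=
    (H.two_four_of_le le_rfl).swap_right
  have h5 : IsAlternatingSignature [2, 5, 5] :=
    (IsAlternatingSignature.isosceles (s := 2) h4).rotate.rotate
  have h6 : IsAlternatingSignature [2, 5, 6] := H.triangle (m := ![2, 5, 6]) (by simp)
  have h9 : IsAlternatingSignature [2, 5, 9] := H.triangle (m := ![2, 5, 9]) (by simp)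
  have hprime : ∀ p, p.Prime → 7 ≤ p → p ∣ n → IsAlternatingSignature [2, 5, n] :=
    fun p hp h7 hpn => key p hpn
      (H.primes Nat.prime_two Nat.prime_five hp (by norm_num) (by omega) h7)
  rcases exists_dvd_three_or_four_or_five_or_prime (by omega : 3 ≤ n) with
    ⟨k, hk⟩ | h | h | ⟨p, hp, h7, hpn⟩
  · by_cases h2 : k = 2
    · exact key 6 (by omega) h6
    rcases exists_dvd_three_or_four_or_five_or_prime (by omega : 3 ≤ k) with
      h | h | h | ⟨p, hp, h7, hpn⟩
    · exact key 9 (by omega) h9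
    · exact key 4 (by omega) h4
    · exact key 5 (by omega) h5
    · exact hprime p hp h7 (hk ▸ hpn.mul_left 3)
  · exact key 4 h h4
  · exact key 5 h h5
  · exact hprime p hp h7 hpn

theorem two_prime (H : BaseSignaturesAlternating) {p n : ℕ} (hp : p.Prime) (h7 : 7 ≤ p)
    (hn : 3 ≤ n) : IsAlternatingSignature [2, p, n] := by
  rcases exists_dvd_three_or_four_or_five_or_prime hn with h | h | h | ⟨q, hq, hq7, h⟩
  · exact (H.two_three h7).swap_right.dvd dvd_rfl dvd_rfl h
  · exact (H.two_four_of_le (by omega)).swap_right.dvd dvd_rfl dvd_rfl h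
  · exact (H.two_five (by omega)).swap_right.dvd dvd_rfl dvd_rfl h
  · refine IsAlternatingSignature.dvd ?_ dvd_rfl dvd_rfl h
    rcases lt_trichotomy p q with hpq | rfl | hpq
    · exact H.primes Nat.prime_two hp hq (by omega) hpq hq7
    -- Equal primes are not a base case; (2, p, p) is the isosceles cover of (2, p, 4).
    · have h4 : IsAlternatingSignature [2, p, 2 * 2] := (H.two_four_of_le (by omega)).swap_right
      exact h4.isosceles.rotate.rotate
    · exact (H.primes Nat.prime_two hq hp (by omega) hpq h7).swap_right

theorem two (H : BaseSignaturesAlternating) {a b : ℕ} (ha : 3 ≤ a) (hb : 3 ≤ b)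
    (hab : 2 * (a + b) < a * b) : IsAlternatingSignature [2, a, b] := by
  rcases lt_or_ge b 7 with hb7 | hb7
  · interval_cases b
    · exact (H.two_three (by omega)).swap_right
    · exact (H.two_four_of_le (by omega)).swap_right
    · exact (H.two_five (by omega)).swap_right
    · rcases exists_dvd_three_or_four_or_five_or_prime ha with h | h | h | ⟨p, hp, h7, h⟩
      · by_cases h6 : a = 6
        · subst h6
          have h4 : IsAlternatingSignature [2, 6, 2 * 2] :=
            (H.two_four_of_le (by omega)).swap_right
          exact h4.isosceles.rotate.rotate
        · exact (H.two_three (n := a) (by omega)).swap_right.dvd dvd_rfl dvd_rfl (by norm_num)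
      · exact (H.two_four_of_le (by omega)).dvd dvd_rfl h dvd_rfl
      · exact (H.two_five (by omega)).dvd dvd_rfl h dvd_rfl
      · exact (H.two_prime hp h7 hb).dvd dvd_rfl h dvd_rfl
  · rcases exists_dvd_three_or_four_or_five_or_prime ha with h | h | h | ⟨p, hp, h7, h⟩
    · exact (H.two_three hb7).dvd dvd_rfl h dvd_rfl
    · exact (H.two_four_of_le (by omega)).dvd dvd_rfl h dvd_rfl
    · exact (H.two_five (by omega)).dvd dvd_rfl h dvd_rfl
    · exact (H.two_prime hp h7 hb).dvd dvd_rfl h dvd_rfl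

theorem isosceles (H : BaseSignaturesAlternating) {r s : ℕ} (hr : 3 ≤ r) (hs : 2 ≤ s)
    (h : r + 2 * s < r * s) : IsAlternatingSignature [r, r, s] :=
  (H.two hr (by omega) (by linarith [mul_left_comm r 2 s])).isosceles

theorem three_four (H : BaseSignaturesAlternating) {n : ℕ} (hn : 3 ≤ n) :
    IsAlternatingSignature [3, 4, n] := by
  rcases exists_dvd_three_or_four_or_five_or_prime hn with h | h | h | ⟨p, hp, h7, h⟩
  · exact (H.isosceles (r := 3) (s := 4) (by omega) (by omega) (by omega)).swap_right.dvd
      dvd_rfl dvd_rfl h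
  · exact (H.isosceles (r := 4) (s := 3) (by omega) (by omega) (by omega)).rotate.rotate.dvd
      dvd_rfl dvd_rfl h
  · have h5 : IsAlternatingSignature [3, 4, 5] := H.triangle (m := ![3, 4, 5]) (by simp)
    exact h5.dvd dvd_rfl dvd_rfl h
  · exact (H.two_three h7).swap.dvd dvd_rfl (by norm_num) h

theorem three_five (H : BaseSignaturesAlternating) {n : ℕ} (hn : 3 ≤ n) :
    IsAlternatingSignature [3, 5, n] := by
  rcases exists_dvd_three_or_four_or_five_or_prime hn with h | h | h | ⟨p, hp, h7, h⟩
  · exact (H.isosceles (r := 3) (s := 5) (by omega) (by omega) (by omega)).swap_right.dvd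
      dvd_rfl dvd_rfl h
  · exact (H.three_four (n := 5) (by omega)).swap_right.dvd dvd_rfl dvd_rfl h
  · exact (H.isosceles (r := 5) (s := 3) (by omega) (by omega) (by omega)).rotate.rotate.dvd
      dvd_rfl dvd_rfl h
  · exact (H.primes Nat.prime_three Nat.prime_five hp (by omega) (by omega) h7).dvd
      dvd_rfl dvd_rfl h

/-- Divisibility reduces a to 2 unless (2, b, c) fails to be hyperbolic. With b, c ≥ 3 that failure
means (b - 2)(c - 2) ≤ 4, which leaves finitely many pairs. -/
theorem even (H : BaseSignaturesAlternating) {a b c : ℕ} (ha : 2 ≤ a) (hb : 2 ≤ b) (hc : 2 ≤ c)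
    (habc : b * c + a * c + a * b < a * b * c) (heven : 2 ∣ a) :
    IsAlternatingSignature [a, b, c] := by
  have aux : ∀ {u v : ℕ}, 2 ≤ u → 2 ≤ v → 2 * (u + v) < u * v →
      IsAlternatingSignature [2, u, v] := by
    intro u v hu hv h
    refine H.two ?_ ?_ h
    · by_contra! h'
      obtain rfl : u = 2 := by omega
      omega
    · by_contra! h'
      obtain rfl : v = 2 := by omega
      omega
  by_cases hb2 : b = 2
  · subst hb2
    exact (aux ha hc (by nlinarith)).swap
  by_cases hc2 : c = 2
  · subst hc2
    exact (aux ha hb (by nlinarith)).rotate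
  by_cases hbc : 2 * (b + c) < b * c
  · exact (aux hb hc hbc).dvd heven dvd_rfl dvd_rfl
  -- For a = 2 the hyperbolicity of (a, b, c) is the inequality just refuted.
  have ha4 : 4 ≤ a := by
    by_contra! h'
    obtain rfl : a = 2 := by omega
    exact hbc (by linarith)
  have hb6 : b ≤ 6 := by
    have : 3 ≤ c := by omega
    nlinarith
  have hb3 : 3 ≤ b := by omega
  have h33 : IsAlternatingSignature [a, 3, 3] :=
    (H.isosceles (r := 3) (by omega) ha (by omega)).rotate.rotate
  have h44 : IsAlternatingSignature [a, 4, 4] :=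
    (H.isosceles (r := 4) (by omega) ha (by omega)).rotate.rotate
  have h34 : IsAlternatingSignature [a, 3, 4] := (H.three_four (by omega)).rotate.rotate
  have h35 : IsAlternatingSignature [a, 3, 5] := (H.three_five (by omega)).rotate.rotate
  have h36 : IsAlternatingSignature [a, 3, 6] := h33.dvd dvd_rfl dvd_rfl (by norm_num)
  clear habc
  interval_cases b
  · have : c = 3 ∨ c = 4 ∨ c = 5 ∨ c = 6 := by omega
    rcases this with rfl | rfl | rfl | rfl
    exacts [h33, h34, h35, h36]
  · have : c = 3 ∨ c = 4 := by omega
    rcases this with rfl | rfl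
    exacts [h34.swap_right, h44]
  · obtain rfl : c = 3 := by omega
    exact h35.swap_right
  · obtain rfl : c = 3 := by omega
    exact h36.swap_right

theorem distinct_primes (H : BaseSignaturesAlternating) {p q r : ℕ} (hp : p.Prime) (hq : q.Prime)
    (hr : r.Prime) (hp3 : 3 ≤ p) (hq3 : 3 ≤ q) (hr3 : 3 ≤ r) (hpq : p ≠ q) (hqr : q ≠ r)
    (hpr : p ≠ r) : IsAlternatingSignature [p, q, r] := by
  have hp' := hp.eq_two_or_three_or_five_or_seven_le
  have hq' := hq.eq_two_or_three_or_five_or_seven_le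
  have hr' := hr.eq_two_or_three_or_five_or_seven_le
  rcases lt_or_gt_of_ne hpq with h₁ | h₁ <;> rcases lt_or_gt_of_ne hqr with h₂ | h₂ <;>
    rcases lt_or_gt_of_ne hpr with h₃ | h₃
  · exact H.primes hp hq hr h₁ h₂ (by omega)
  · omega
  · exact (H.primes hp hr hq h₃ h₂ (by omega)).swap_right
  · exact (H.primes hr hp hq h₃ h₁ (by omega)).rotate
  · exact (H.primes hq hp hr h₁ h₃ (by omega)).swap
  · exact (H.primes hq hr hp h₂ h₃ (by omega)).rotate.rotate
  · omega
  · exact (H.primes hr hq hp h₂ h₁ (by omega)).rotate.swap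

theorem of_common_prime (H : BaseSignaturesAlternating) {p a b c : ℕ} (hp : p.Prime) (hp3 : 3 ≤ p)
    (ha : p ∣ a) (hb : p ∣ b) (hc : 3 ≤ c) (ha0 : 0 < a) (hb0 : 0 < b)
    (habc : b * c + a * c + a * b < a * b * c) : IsAlternatingSignature [a, b, c] := by
  by_cases h : p + 2 * c < p * c
  · exact (H.isosceles hp3 (by omega) h).dvd ha hb dvd_rfl
  -- The only non-hyperbolic (p, p, c) here is the Euclidean (3, 3, 3); then a or b exceeds 3, and
  -- that period is kept unreduced.
  obtain rfl : p = 3 := by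
    have := hp.eq_two_or_three_or_five_or_seven_le
    by_contra h'
    have : 5 ≤ p := by omega
    nlinarith
  obtain rfl : c = 3 := by omega
  have ha3 := Nat.le_of_dvd ha0 ha
  have hb3 := Nat.le_of_dvd hb0 hb
  rcases Nat.lt_or_ge a 4 with ha4 | ha4
  · obtain rfl : a = 3 := by omega
    exact (H.isosceles (r := 3) (s := b) (by omega) (by omega) (by omega)).swap_right
  · exact (H.isosceles (r := 3) (s := a) (by omega) (by omega) (by omega)).rotate.rotate.dvd
      dvd_rfl hb dvd_rfl

/-- Once even periods are excluded, each period has an odd prime factor. Either two periods share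
the chosen prime, or the three primes are distinct and the triple they form is a base case. -/
theorem triple (H : BaseSignaturesAlternating) {a b c : ℕ} (ha : 2 ≤ a) (hb : 2 ≤ b) (hc : 2 ≤ c)
    (habc : b * c + a * c + a * b < a * b * c) : IsAlternatingSignature [a, b, c] := by
  by_cases h2a : 2 ∣ a
  · exact H.even ha hb hc habc h2a
  by_cases h2b : 2 ∣ b
  · exact (H.even hb ha hc (by linarith [mul_comm a b]) h2b).swap
  by_cases h2c : 2 ∣ c
  · refine (H.even hc ha hb ?_ h2c).rotate
    linarith [mul_comm a c, mul_comm b c, mul_comm (a * b) c, mul_assoc c a b]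
  have aux : ∀ n, 2 ≤ n → ¬ 2 ∣ n → 3 ≤ n ∧ ∃ p, p.Prime ∧ 3 ≤ p ∧ p ∣ n := by
    intro n hn h2
    obtain ⟨p, hp, hpn⟩ := Nat.exists_prime_and_dvd (n := n) (by omega)
    refine ⟨by omega, p, hp, ?_, hpn⟩
    have := hp.two_le
    by_contra! h
    obtain rfl : p = 2 := by omega
    exact h2 hpn
  obtain ⟨ha3, p, hp, hp3, hpa⟩ := aux a ha h2a
  obtain ⟨hb3, q, hq, hq3, hqb⟩ := aux b hb h2b
  obtain ⟨hc3, r, hr, hr3, hrc⟩ := aux c hc h2c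
  by_cases hpq : p = q
  · subst hpq
    exact H.of_common_prime hp hp3 hpa hqb hc3 (by omega) (by omega) habc
  by_cases hqr : q = r
  · subst hqr
    refine (H.of_common_prime hq hq3 hqb hrc ha3 (by omega) (by omega) ?_).rotate.rotate
    linarith [mul_comm a b, mul_comm a c, mul_comm a (b * c), mul_assoc a b c]
  by_cases hpr : p = r
  · subst hpr
    refine (H.of_common_prime hp hp3 hpa hrc hb3 (by omega) (by omega) ?_).swap_right
    linarith [mul_comm b c, mul_right_comm a b c]
  exact (H.distinct_primes hp hq hr hp3 hq3 hr3 hpq hqr hpr).dvd hpa hqb hrc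

/-! ### Four or more periods -/

theorem two_two (H : BaseSignaturesAlternating) {a b c d : ℕ} (ha : 2 ∣ a) (hb : 2 ∣ b)
    (hc : 2 ≤ c) (hd : 2 ≤ d) (hcd : 5 ≤ c + d) : IsAlternatingSignature [a, b, c, d] := by
  -- The triangle (2c, 2d, 2) is hyperbolic because c, d ≥ 2 are not both 2; its double cover has
  -- signature (c, d, 2, 2).
  have h : IsAlternatingSignature [2 * c, 2 * d, 2] :=
    (H.two (a := 2 * c) (b := 2 * d) (by omega) (by omega) (by nlinarith)).rotate
  have h' : IsAlternatingSignature [2, 2, c, d] :=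
    h.double_cover.perm (List.perm_append_comm (l₁ := [c, d]) (l₂ := [2, 2]))
  exact h'.of_forall_dvd (.cons ha (.cons hb (.cons dvd_rfl (.cons dvd_rfl .nil))))

theorem three_of_three_le (H : BaseSignaturesAlternating) {a b c d : ℕ} (ha : 2 ≤ a) (hb : 3 ≤ b)
    (hc : 3 ≤ c) (hd : 3 ≤ d) : IsAlternatingSignature [a, b, c, d] := by
  by_cases h : c * d + b * d + b * c < b * c * d
  · exact (H.triple (by omega) (by omega) (by omega) h).cons a
  obtain ⟨rfl, rfl, rfl⟩ : b = 3 ∧ c = 3 ∧ d = 3 := by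
    have hbc := Nat.mul_le_mul hb hc
    have hcd := Nat.mul_le_mul hc hd
    have hbd := Nat.mul_le_mul hb hd
    have h₁ := Nat.mul_le_mul hb hcd
    refine ⟨?_, ?_, ?_⟩
    · nlinarith
    · nlinarith
    · nlinarith
  rcases lt_or_ge a 4 with ha4 | ha4
  · interval_cases a
    · exact H.two_three_three_three
    · exact H.three_three_three_three
  · have h3 : IsAlternatingSignature [3, 3, a] := H.isosceles (by omega) ha (by omega)
    exact (h3.cons 3).perm (List.perm_append_comm (l₁ := [3, 3, 3]) (l₂ := [a]))

theorem quadruple_of_two_even (H : BaseSignaturesAlternating) {a b c d : ℕ} (ha : 2 ≤ a)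
    (hb : 2 ≤ b) (hc : 2 ≤ c) (hd : 2 ≤ d) (h : 9 ≤ a + b + c + d) (h2a : 2 ∣ a) (h2b : 2 ∣ b) :
    IsAlternatingSignature [a, b, c, d] := by
  by_cases hcd : 5 ≤ c + d
  · exact H.two_two h2a h2b hc hd hcd
  · exact (H.two_two (a := c) (b := d) (by omega) (by omega) ha hb (by omega)).perm
      (List.perm_append_comm (l₁ := [c, d]) (l₂ := [a, b]))

/-- Either two periods are even, or three are odd and hence at least 3. The bound 9 on the sum
excludes only (2, 2, 2, 2). -/
theorem quadruple (H : BaseSignaturesAlternating) {a b c d : ℕ} (ha : 2 ≤ a)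
    (hb : 2 ≤ b) (hc : 2 ≤ c) (hd : 2 ≤ d) (h : 9 ≤ a + b + c + d) :
    IsAlternatingSignature [a, b, c, d] := by
  have hbfirst : [b, a, c, d].Perm [a, b, c, d] := .swap _ _ _
  have hcfirst : [c, a, b, d].Perm [a, b, c, d] :=
    (List.Perm.swap _ _ _).trans (.cons _ (.swap _ _ _))
  have hdfirst : [d, a, b, c].Perm [a, b, c, d] := List.perm_append_comm (l₁ := [d])
  by_cases h2a : 2 ∣ a
  · by_cases h2b : 2 ∣ b
    · exact H.quadruple_of_two_even ha hb hc hd h h2a h2b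
    by_cases h2c : 2 ∣ c
    · exact (H.quadruple_of_two_even ha hc hb hd (by omega) h2a h2c).perm (.cons _ (.swap _ _ _))
    by_cases h2d : 2 ∣ d
    · exact (H.quadruple_of_two_even ha hd hb hc (by omega) h2a h2d).perm
        (.cons _ (List.perm_append_comm (l₁ := [d])))
    exact H.three_of_three_le ha (by omega) (by omega) (by omega)
  by_cases h2b : 2 ∣ b
  · by_cases h2c : 2 ∣ c
    · exact (H.quadruple_of_two_even hb hc ha hd (by omega) h2b h2c).perm
        ((List.Perm.cons _ (.swap _ _ _)).trans hbfirst)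
    by_cases h2d : 2 ∣ d
    · exact (H.quadruple_of_two_even hb hd ha hc (by omega) h2b h2d).perm
        ((List.Perm.cons _ (List.perm_append_comm (l₁ := [d]))).trans hbfirst)
    exact (H.three_of_three_le hb (by omega) (by omega) (by omega)).perm hbfirst
  by_cases h2c : 2 ∣ c
  · by_cases h2d : 2 ∣ d
    · exact (H.quadruple_of_two_even hc hd ha hb (by omega) h2c h2d).perm
        (List.perm_append_comm (l₁ := [c, d]) (l₂ := [a, b]))
    exact (H.three_of_three_le hc (by omega) (by omega) (by omega)).perm hcfirst
  exact (H.three_of_three_le hd (by omega) (by omega) (by omega)).perm hdfirst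

theorem of_three_le_mem (H : BaseSignaturesAlternating) {l : List ℕ} {x : ℕ}
    (hl : ∀ k ∈ l, 2 ≤ k) (hlen : 4 ≤ l.length) (hx : 3 ≤ x) (hxl : x ∈ l) :
    IsAlternatingSignature l := by
  have hperm := List.perm_cons_erase hxl
  have hle : ∀ k ∈ l.erase x, 2 ≤ k := fun k hk => hl k (List.mem_of_mem_erase hk)
  have hlen' := hperm.length_eq
  refine IsAlternatingSignature.perm ?_ hperm.symm
  generalize l.erase x = t at hle hlen'
  match t, hle, hlen' with
  | a :: b :: c :: t, hle, _ =>
    simp only [List.forall_mem_cons] at hle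
    have h := H.quadruple (by omega) hle.1 hle.2.1 hle.2.2.1 (by omega : 9 ≤ x + a + b + c)
    exact (h.append_left t).perm List.perm_append_comm
  | [], _, h => simp at h; omega
  | [_], _, h => simp at h; omega
  | [_, _], _, h => simp at h; omega

theorem of_five_le_length (H : BaseSignaturesAlternating) {l : List ℕ}
    (hl : ∀ k ∈ l, 2 ≤ k) (hlen : 5 ≤ l.length) : IsAlternatingSignature l := by
  by_cases h : ∃ x ∈ l, 3 ≤ x
  · obtain ⟨x, hxl, hx⟩ := h
    exact H.of_three_le_mem hl (by omega) hx hxl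
  · push Not at h
    have h2 : l = List.replicate l.length 2 := by
      rw [List.eq_replicate_iff]
      refine ⟨rfl, fun k hk => ?_⟩
      have := hl k hk
      have := h k hk
      omega
    -- When all periods are 2, no four of them are hyperbolic; five of them arise as the double
    -- cover of (2, 4, 2, 2) after dropping a 1.
    have h4 : IsAlternatingSignature [2 * 1, 2 * 2, 2, 2] :=
      (H.quadruple (a := 4) (b := 2) (c := 2) (d := 2) (by omega) (by omega) (by omega) (by omega)
        (by omega)).perm ((List.Perm.swap _ _ _))
    have h5 : IsAlternatingSignature (List.replicate 5 2) := h4.double_cover.of_one_cons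
    obtain ⟨k, hk⟩ := Nat.exists_eq_add_of_le' hlen
    rw [h2, hk, ← List.replicate_append_replicate]
    exact h5.append_left _

theorem of_hyperbolic (H : BaseSignaturesAlternating) {l : List ℕ} (hl : ∀ k ∈ l, 2 ≤ k)
    (hpos : 0 < -2 + (l.map fun k : ℕ => 1 - 1 / (k : ℚ)).sum) : IsAlternatingSignature l := by
  have hlt : ∀ {k : ℕ}, 2 ≤ k → 0 < 1 / (k : ℚ) := fun hk => by positivity
  match l with
  | [] => norm_num at hpos
  | [a] =>
    simp only [List.forall_mem_cons] at hl
    have := hlt hl.1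
    simp only [List.map_cons, List.map_nil, List.sum_cons, List.sum_nil] at hpos
    linarith
  | [a, b] =>
    simp only [List.forall_mem_cons] at hl
    have := hlt hl.1
    have := hlt hl.2.1
    simp only [List.map_cons, List.map_nil, List.sum_cons, List.sum_nil] at hpos
    linarith
  | [a, b, c] =>
    simp only [List.forall_mem_cons] at hl
    obtain ⟨ha, hb, hc, -⟩ := hl
    refine H.triple ha hb hc ?_
    simp only [List.map_cons, List.map_nil, List.sum_cons, List.sum_nil] at hpos
    have ha' : (0 : ℚ) < a := by positivity
    have hb' : (0 : ℚ) < b := by positivity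
    have hc' : (0 : ℚ) < c := by positivity
    have h := mul_pos (mul_pos (mul_pos ha' hb') hc') hpos
    have h' : (a * b * c : ℚ) * (-2 + (1 - 1 / a + (1 - 1 / b + (1 - 1 / c + 0)))) =
        a * b * c - (b * c + a * c + a * b) := by
      field_simp
      ring
    rw [h', sub_pos] at h
    exact_mod_cast h
  | [a, b, c, d] =>
    by_cases h : ∃ x ∈ [a, b, c, d], 3 ≤ x
    · obtain ⟨x, hxl, hx⟩ := h
      exact H.of_three_le_mem hl le_rfl hx hxl
    · push Not at h
      simp only [List.forall_mem_cons] at hl h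
      obtain rfl : a = 2 := by omega
      obtain rfl : b = 2 := by omega
      obtain rfl : c = 2 := by omega
      obtain rfl : d = 2 := by omega
      norm_num at hpos
  | _ :: _ :: _ :: _ :: _ :: t => exact H.of_five_le_length hl (by simp)

end BaseSignaturesAlternating

/-! ### Back to Dyck groups -/

/-- The reciprocals sum to at most 1/2 + 1/3 + 1/7 = 41/42. -/
theorem isFuchsianSignature_of_primes {p q r : ℕ} (hp : p.Prime) (hpq : p < q)
    (hr : 7 ≤ r) : IsFuchsianSignature ![p, q, r] := by
  have hp2 := hp.two_le
  refine ⟨fun i => by fin_cases i <;> simp <;> omega, ?_⟩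
  have h₁ : (1 : ℚ) / p ≤ 1 / 2 := one_div_le_one_div_of_le (by norm_num) (by exact_mod_cast hp2)
  have h₂ : (1 : ℚ) / q ≤ 1 / 3 :=
    one_div_le_one_div_of_le (by norm_num) (by exact_mod_cast (by omega : 3 ≤ q))
  have h₃ : (1 : ℚ) / r ≤ 1 / 7 := one_div_le_one_div_of_le (by norm_num) (by exact_mod_cast hr)
  simp only [dyckMu, Fin.sum_univ_three, Matrix.cons_val]
  linarith

theorem mainTheorem3
    (h₁ : ∀ p q r : ℕ, p.Prime → q.Prime → r.Prime → p < q → q < r →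
      IsFuchsianSignature ![p, q, r] → SurjectsAlmostAllAlternating (DyckGroup ![p, q, r]))
    (h₂ : ∀ r : ℕ, r.Prime → 5 ≤ r → SurjectsAlmostAllAlternating (DyckGroup ![2, 4, r]))
    (h₃ : ∀ m ∈ ([![2, 3, 8], ![2, 3, 9], ![2, 3, 10], ![2, 3, 12], ![2, 3, 15], ![2, 3, 25],
        ![2, 4, 6], ![2, 4, 8], ![2, 4, 9], ![2, 5, 6], ![2, 5, 9], ![3, 4, 5]] :
        List (Fin 3 → ℕ)),
      SurjectsAlmostAllAlternating (DyckGroup m))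
    (h₄ : SurjectsAlmostAllAlternating (DyckGroup ![2, 3, 3, 3]))
    (h₄' : SurjectsAlmostAllAlternating (DyckGroup ![3, 3, 3, 3]))
    {e : ℕ} (m : Fin e → ℕ) (hm : IsFuchsianSignature m) :
    SurjectsAlmostAllAlternating (DyckGroup m) := by
  have H : BaseSignaturesAlternating :=
    { primes := fun hp hq hr hpq hqr h7 => (surjectsAlmostAllAlternating_iff _).1
        (h₁ _ _ _ hp hq hr hpq hqr (isFuchsianSignature_of_primes hp hpq h7))
      two_four := fun hr h5 => (surjectsAlmostAllAlternating_iff _).1 (h₂ _ hr h5)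
      triangle := fun hm => (surjectsAlmostAllAlternating_iff _).1 (h₃ _ hm)
      two_three_three_three := (surjectsAlmostAllAlternating_iff _).1 h₄
      three_three_three_three := (surjectsAlmostAllAlternating_iff _).1 h₄' }
  refine (surjectsAlmostAllAlternating_iff m).2 (H.of_hyperbolic ?_ ?_)
  · intro k hk
    obtain ⟨i, rfl⟩ := (List.mem_ofFn' _ _).1 hk
    exact hm.1 i
  · rw [List.map_ofFn, List.sum_ofFn]
    exact hm.2
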